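/- Let $M$ be a nonderogatory real $n\times n$ matrix, i.e. one whose characteristic and minimal polynomials coincide. Let $\mathcal G_M=\mathbb R[M]\ltimes\mathbb R^n$ be the real Lie algebra with underlying vector space $\mathbb R[M]\oplus\mathbb R^n$, where $\mathbb R[M]$ is the algebra of polynomials in $M$, and bracket $[a,b]=0$, $[x,y]=0$, $[a,x]=ax$ for $a,b\in\mathbb R[M]$ and $x,y\in\mathbb R^n$. Write $\mathfrak D_0^n=\mathcal G_{M_0}$ with $M_0=\sum_{i=1}^{n-1}E_{i,i+1}$ and, for even $n\ge 2$, $\mathfrak D_{0,1}^n=\mathcal G_{M_{0,1}}$ with $$M_{0,1}=-\sum_{j=0}^{n/2-1}\left(E_{2j+1,2j+2}-E_{2j+2,2j+1}\right)+\sum_{j=1}^{n-2}E_{j,j+2}.$$ A Lie algebra is called indecomposable if it is nonzero and is not the direct sum of two nonzero ideals; a finite-dimensional real Lie algebra is called completely solvable if it is solvable and, for every element $x$, all eigenvalues of $\operatorname{ad}x$ are real. Eigenvalues of $M$ are taken in $\mathbb C$. Then $\mathcal G_M$ is indecomposable if and only if one of the following holds: (a) $M$ has a unique eigenvalue; in this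 case the eigenvalue is real, $\mathcal G_M$ is isomorphic to $\mathfrak D_0^n$, and $\mathcal G_M$ is completely solvable; (b) $M$ has exactly two eigenvalues, and they are nonreal and complex conjugate to each other; in this case $n$ is even and $\mathcal G_M$ is isomorphic to $\mathfrak D_{0,1}^n$. -/

import Mathlib

open scoped ComplexConjugate

attribute [local instance] LieRing.ofAssociativeRing

/-- A square matrix is nonderogatory (cyclic) if its characteristic polynomial coincides with its
minimal polynomial. -/
def IsNonderogatory {n : ℕ} (M : Matrix (Fin n) (Fin n) ℝ) : Prop :=
  M.charpoly = minpoly ℝ M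

/-- The set of (complex) eigenvalues of a real square matrix. -/
def complexEigenvalues {n : ℕ} (M : Matrix (Fin n) (Fin n) ℝ) : Set ℂ :=
  {z | Module.End.HasEigenvalue (Matrix.toLin' (M.map (algebraMap ℝ ℂ))) z}

/-- `ℝⁿ` as an abelian Lie algebra: its bracket is the commutator of the commutative ring `ℝⁿ`. -/
theorem vec_lie_eq_zero {n : ℕ} (x y : Fin n → ℝ) : ⁅x, y⁆ = 0 := by
  ext i
  simp [Ring.lie_def, mul_comm]

/-- The action `ρ(a) x = a x` of a square matrix on `ℝⁿ`, as a derivation of the abelian Lie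
algebra `ℝⁿ`. -/
def mulVecDerivation {n : ℕ} (a : Matrix (Fin n) (Fin n) ℝ) :
    LieDerivation ℝ (Fin n → ℝ) (Fin n → ℝ) where
  toLinearMap := Matrix.mulVecLin a
  leibniz' x y := by simp only [vec_lie_eq_zero, map_zero, sub_zero]

/-- The action of a Lie subalgebra of `𝔤𝔩(n, ℝ)` on the abelian Lie algebra `ℝⁿ`. -/
def vecAction {n : ℕ} (B : LieSubalgebra ℝ (Matrix (Fin n) (Fin n) ℝ)) :
    B →ₗ⁅ℝ⁆ LieDerivation ℝ (Fin n → ℝ) (Fin n → ℝ) where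
  toFun a := mulVecDerivation a
  map_add' a b := by
    ext x : 1
    exact Matrix.add_mulVec _ _ x
  map_smul' c a := by
    ext x : 1
    exact Matrix.smul_mulVec c _ x
  map_lie' := by
    intro a b
    ext x : 1
    rw [LieDerivation.lie_apply]
    change ((a : Matrix (Fin n) (Fin n) ℝ) * b - b * a).mulVec x
      = Matrix.mulVec a.1 (Matrix.mulVec b.1 x) - Matrix.mulVec b.1 (Matrix.mulVec a.1 x)
    rw [Matrix.sub_mulVec, Matrix.mulVec_mulVec, Matrix.mulVec_mulVec]

/-- `ℝ[M]`, the algebra of polynomials in `M`, as a Lie subalgebra of `𝔤𝔩(n, ℝ)`. -/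
def polyLie {n : ℕ} (M : Matrix (Fin n) (Fin n) ℝ) :
    LieSubalgebra ℝ (Matrix (Fin n) (Fin n) ℝ) :=
  lieSubalgebraOfSubalgebra ℝ _ (Algebra.adjoin ℝ {M})

/-- The Lie algebra `𝒢_M = ℝ[M] ⋉ ℝⁿ`. -/
abbrev GLie {n : ℕ} (M : Matrix (Fin n) (Fin n) ℝ) : Type :=
  LieAlgebra.SemiDirectSum (Fin n → ℝ) (polyLie M) (vecAction (polyLie M))

/-- The brackets of `𝒢_M`: `[a + x, b + y] = a y - b x` for `a, b ∈ ℝ[M]` and `x, y ∈ ℝⁿ`. -/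
theorem GLie.lie_eq {n : ℕ} (M : Matrix (Fin n) (Fin n) ℝ) (u v : GLie M) :
    ⁅u, v⁆ = ⟨Matrix.mulVec (u.right : Matrix (Fin n) (Fin n) ℝ) v.left
      - Matrix.mulVec (v.right : Matrix (Fin n) (Fin n) ℝ) u.left, 0⟩ := by
  have hcomm : ⁅u.right, v.right⁆ = 0 := by
    have h : Commute (u.right : Matrix (Fin n) (Fin n) ℝ) v.right :=
      Algebra.commute_of_mem_adjoin_singleton_of_commute v.right.2
        (Algebra.commute_of_mem_adjoin_self u.right.2).symm
    apply Subtype.ext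
    rw [LieSubalgebra.coe_bracket, Ring.lie_def, h.eq, sub_self]
    rfl
  ext1
  · change ⁅u.left, v.left⁆ + _ - _ = _
    rw [vec_lie_eq_zero, zero_add]
    rfl
  · exact hcomm

instance GLie.finite {n : ℕ} (M : Matrix (Fin n) (Fin n) ℝ) : Module.Finite ℝ (GLie M) :=
  haveI : Module.Finite ℝ (polyLie M) :=
    inferInstanceAs (Module.Finite ℝ (polyLie M).toSubmodule)
  Module.Finite.equiv (LieAlgebra.SemiDirectSum.toProdl (vecAction (polyLie M))).symm

/-- The principal nilpotent matrix `M₀ = ∑ E_{i,i+1}` of size `n`. -/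
def nilpotentBlock (n : ℕ) : Matrix (Fin n) (Fin n) ℝ :=
  Matrix.of fun i j => if j.val = i.val + 1 then 1 else 0

/-- The Lie algebra `𝔇₀ⁿ`. -/
abbrev D0 (n : ℕ) : Type := GLie (nilpotentBlock n)

/-- For even `n`, the matrix `M_{0,1} = M_s + M_n`: `M_s` is block diagonal with `2 × 2` blocks
`!![0, -1; 1, 0]`, and `M_n = ∑ E_{j,j+2}` has identity blocks just above the diagonal blocks.
(Indices start at `0`, so the blocks start at even indices.) -/
def complexBlock (n : ℕ) : Matrix (Fin n) (Fin n) ℝ :=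
  Matrix.of fun i j =>
    if Even i.val ∧ j.val = i.val + 1 then -1
    else if Even j.val ∧ i.val = j.val + 1 then 1
    else if j.val = i.val + 2 then 1
    else 0

/-- The Lie algebra `𝔇_{0,1}ⁿ` (for even `n`). -/
abbrev D01 (n : ℕ) : Type := GLie (complexBlock n)

/-- A Lie algebra is indecomposable if it is nonzero and is not the direct sum of two nonzero
ideals. -/
def LieIndecomposable (L : Type*) [LieRing L] [LieAlgebra ℝ L] : Prop :=
  Nontrivial L ∧ ∀ I J : LieIdeal ℝ L, IsCompl I J → I = ⊥ ∨ J = ⊥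

/-- A finite-dimensional real Lie algebra is completely solvable if it is solvable and every
`ad x` has only real eigenvalues. -/
def LieCompletelySolvable (L : Type*) [LieRing L] [LieAlgebra ℝ L] [Module.Finite ℝ L] : Prop :=
  LieAlgebra.IsSolvable L ∧ ∀ x : L, (LieAlgebra.ad ℝ L x).charpoly.Splits

/-! Ideal decompositions of `GLie M` correspond to idempotents of `ℝ[M] ≅ ℝ[X]/(P)`, with `P` the
minimal polynomial. A coprime factorization `P = f g` yields, by Bézout, complementary idempotents
that split the Lie algebra. Conversely, in a decomposition into two ideals the components of `1 ∈
ℝ[M]` have idempotent matrix parts. Hence `GLie M` is indecomposable iff `P = p ^ k` with `p`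
irreducible and `k ≠ 0` (`lieIndecomposable_GLie_iff`). This needs no nonderogatory hypothesis.

A monic irreducible real `p` is the minimal polynomial of some complex `z`. As `P` is also the
characteristic polynomial, the condition says that the eigenvalues are exactly `z` and `conj z`, and
`deg P = n` fixes `k`.

For the normal forms, `ℝ[M]` is unchanged when `M` is replaced by `c M + r`, `c ≠ 0`, so `z` may be
moved to `0` or `i`. Then `M` and the model are both cyclic with the same annihilator `p ^ k` of
degree `n`, hence similar (`Matrix.exists_linearEquiv_intertwining`), and conjugation gives the
isomorphism. -/

open Polynomial

/-! ### Real polynomials and their complex roots -/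

section Polynomials

/-- A monic polynomial over a field is `1`, a power of an irreducible polynomial, or a product of
two coprime nonunits. -/
theorem Polynomial.Monic.eq_one_or_eq_irreducible_pow_or_eq_mul_coprime {K : Type*} [Field K]
    {P : K[X]} (hP : P.Monic) :
    P = 1 ∨ (∃ (p : K[X]) (k : ℕ), p.Monic ∧ Irreducible p ∧ k ≠ 0 ∧ P = p ^ k) ∨
      ∃ f g : K[X], P = f * g ∧ IsCoprime f g ∧ ¬ IsUnit f ∧ ¬ IsUnit g := by
  by_cases hu : IsUnit P
  · exact Or.inl (hP.eq_one_of_isUnit hu)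
  right
  obtain ⟨p, hpm, hpi, hpd⟩ := P.exists_monic_irreducible_factor hu
  obtain ⟨g, hg, hpg⟩ := (finiteMultiplicity_of_degree_pos_of_monic
    (degree_pos_of_irreducible hpi) hpm hP.ne_zero).exists_eq_pow_mul_and_not_dvd
  set k := multiplicity p P
  have hk : k ≠ 0 := by
    intro h
    rw [h, pow_zero, one_mul] at hg
    exact hpg (hg ▸ hpd)
  by_cases hgu : IsUnit g
  · refine Or.inl ⟨p, k, hpm, hpi, hk, ?_⟩
    have hgm : g.Monic := (hpm.pow k).of_mul_monic_left (hg ▸ hP)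
    rw [hg, hgm.eq_one_of_isUnit hgu, mul_one]
  · refine Or.inr ⟨p ^ k, g, hg, (hpi.coprime_iff_not_dvd.2 hpg).pow_left, ?_, hgu⟩
    rw [isUnit_pow_iff hk]
    exact hpi.not_isUnit

/-- The real quadratic with roots `z` and `conj z` divides the irreducible minimal polynomial and is
not a unit, so the two are associated, and both are monic. -/
theorem minpoly_real_complex_eq {z : ℂ} (hz : z.im ≠ 0) :
    minpoly ℝ z = (X - C z.re) ^ 2 + C (z.im ^ 2) := by
  have hi := minpoly.irreducible (IsIntegral.of_finite ℝ z)
  have h := Polynomial.quadratic_dvd_of_aeval_eq_zero_im_ne_zero _ (minpoly.aeval ℝ z) hz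
  have he : (X ^ 2 - C (2 * z.re) * X + C (‖z‖ ^ 2) : ℝ[X]) = (X - C z.re) ^ 2 + C (z.im ^ 2) := by
    rw [← Complex.normSq_eq_norm_sq, Complex.normSq_apply]
    simp only [map_add, map_mul, map_pow, map_ofNat]
    ring
  rw [he] at h
  have hm : ((X - C z.re) ^ 2 + C (z.im ^ 2) : ℝ[X]).Monic := by
    refine ((monic_X_sub_C z.re).pow 2).add_of_left ?_
    rw [degree_pow, degree_X_sub_C]
    exact degree_C_le.trans_lt (by norm_num)
  refine eq_of_monic_of_associated (minpoly.monic (IsIntegral.of_finite ℝ z)) hm ?_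
  have hu : ¬ IsUnit ((X - C z.re) ^ 2 + C (z.im ^ 2) : ℝ[X]) := by
    intro hu
    have := congrArg natDegree (hm.eq_one_of_isUnit hu)
    rw [natDegree_add_C, natDegree_pow, natDegree_X_sub_C, natDegree_one] at this
    exact absurd this (by norm_num)
  exact associated_of_dvd_dvd ((hi.dvd_iff.1 h).resolve_left hu).dvd h

theorem minpoly_real_complex_of_im_eq_zero {z : ℂ} (hz : z.im = 0) :
    minpoly ℝ z = X - C z.re := by
  have : z = algebraMap ℝ ℂ z.re := by
    apply Complex.ext <;> simp [hz]
  conv_lhs => rw [this]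
  exact minpoly.eq_X_sub_C ℂ z.re

theorem aeval_minpoly_real_complex_eq_zero_iff {z w : ℂ} :
    aeval w (minpoly ℝ z) = 0 ↔ w = z ∨ w = conj z := by
  constructor
  · intro h
    by_cases hz : z.im = 0
    · left
      rw [minpoly_real_complex_of_im_eq_zero hz] at h
      simp only [map_sub, aeval_X, aeval_C, sub_eq_zero] at h
      rw [h]
      apply Complex.ext <;> simp [hz]
    · rw [minpoly_real_complex_eq hz] at h
      simp only [map_add, map_pow, map_sub, aeval_X, aeval_C, Complex.coe_algebraMap] at h
      have h2 : (w - z) * (w - conj z) = 0 := by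
        have e1 : z = z.re + z.im * Complex.I := (Complex.re_add_im z).symm
        have e2 : conj z = z.re - z.im * Complex.I := by
          apply Complex.ext <;> simp
        rw [e2]
        nth_rw 1 [e1]
        linear_combination h - (z.im : ℂ) ^ 2 * Complex.I_sq
      rcases mul_eq_zero.1 h2 with h3 | h3
      · exact Or.inl (sub_eq_zero.1 h3)
      · exact Or.inr (sub_eq_zero.1 h3)
  · rintro (rfl | rfl)
    · exact minpoly.aeval ℝ w
    · rw [aeval_conj, minpoly.aeval, map_zero]

/-- If all complex roots of a monic real polynomial are equal or conjugate to `z`, it is a power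
of the minimal polynomial of `z`. -/
theorem Polynomial.Monic.eq_minpoly_pow {P : ℝ[X]} (hP : P.Monic) {z : ℂ}
    (h : ∀ w : ℂ, aeval w P = 0 → w = z ∨ w = conj z) :
    ∃ k, P = minpoly ℝ z ^ k := by
  have key : ∀ p : ℝ[X], p.Monic → Irreducible p → p ∣ P → p = minpoly ℝ z := by
    intro p hm hi hd
    obtain ⟨w, hw⟩ : ∃ w : ℂ, aeval w p = 0 :=
      IsAlgClosed.exists_aeval_eq_zero _ p (degree_pos_of_irreducible hi).ne'
    have hwz := h w (by obtain ⟨q, rfl⟩ := hd; rw [map_mul, hw, zero_mul])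
    rw [minpoly.eq_of_irreducible_of_monic hi hw hm]
    have := aeval_minpoly_real_complex_eq_zero_iff.2 hwz
    exact (minpoly.eq_of_irreducible_of_monic (minpoly.irreducible (IsIntegral.of_finite ℝ z))
      this (minpoly.monic (IsIntegral.of_finite ℝ z))).symm
  rcases hP.eq_one_or_eq_irreducible_pow_or_eq_mul_coprime with h1 | ⟨p, k, hm, hi, hk, rfl⟩ |
    ⟨f, g, rfl, hc, hf, hg⟩
  · exact ⟨0, by rw [h1, pow_zero]⟩
  · exact ⟨k, by rw [key p hm hi (dvd_pow_self p hk)]⟩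
  · exfalso
    obtain ⟨p, hpm, hpi, hpd⟩ := f.exists_monic_irreducible_factor hf
    obtain ⟨q, hqm, hqi, hqd⟩ := g.exists_monic_irreducible_factor hg
    have e := (key p hpm hpi (hpd.mul_right g)).trans (key q hqm hqi (hqd.mul_left f)).symm
    exact hpi.not_isUnit (hc.isUnit_of_dvd' hpd (e ▸ hqd))

end Polynomials

/-! ### Eigenvalues and annihilating polynomials -/

section Eigenvalues

theorem mem_complexEigenvalues_iff {n : ℕ} (M : Matrix (Fin n) (Fin n) ℝ) (z : ℂ) :
    z ∈ complexEigenvalues M ↔ aeval z M.charpoly = 0 := by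
  change Module.End.HasEigenvalue _ z ↔ _
  rw [Module.End.hasEigenvalue_iff_isRoot_charpoly, Matrix.charpoly_toLin', Matrix.charpoly_map,
    IsRoot.def, eval_map_algebraMap]

theorem conj_mem_complexEigenvalues {n : ℕ} {M : Matrix (Fin n) (Fin n) ℝ} {z : ℂ}
    (h : z ∈ complexEigenvalues M) : conj z ∈ complexEigenvalues M := by
  rw [mem_complexEigenvalues_iff] at h ⊢
  rw [aeval_conj, h, map_zero]

theorem complexEigenvalues_eq {n : ℕ} {M : Matrix (Fin n) (Fin n) ℝ} {z : ℂ} {k : ℕ} (hk : k ≠ 0)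
    (h : M.charpoly = minpoly ℝ z ^ k) : complexEigenvalues M = {z, conj z} := by
  ext w
  rw [mem_complexEigenvalues_iff, h, map_pow, pow_eq_zero_iff hk,
    aeval_minpoly_real_complex_eq_zero_iff]
  rfl

/-- On a complex eigenvector for `w`, `q(A)` acts as the scalar `q(w)`. -/
theorem Matrix.aeval_eq_zero_of_aeval_charpoly_eq_zero {ι : Type*} [Fintype ι] [DecidableEq ι]
    {A : Matrix ι ι ℝ} {q : ℝ[X]} (h : aeval A q = 0) {w : ℂ} (hw : aeval w A.charpoly = 0) :
    aeval w q = 0 := by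
  have he : Module.End.HasEigenvalue (Matrix.toLin' (A.map (algebraMap ℝ ℂ))) w := by
    rwa [Module.End.hasEigenvalue_iff_isRoot_charpoly, Matrix.charpoly_toLin', Matrix.charpoly_map,
      IsRoot.def, eval_map_algebraMap]
  obtain ⟨v, hv⟩ := he.exists_hasEigenvector
  have h0 : aeval (Matrix.toLin' (A.map (algebraMap ℝ ℂ))) (q.map (algebraMap ℝ ℂ)) = 0 := by
    have e1 : aeval (A.map (algebraMap ℝ ℂ)) q = 0 := by
      have := aeval_algHom_apply (Algebra.ofId ℝ ℂ).mapMatrix A q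
      rw [h, map_zero] at this
      exact this
    have e2 := aeval_algHom_apply (Matrix.toLinAlgEquiv' : _ ≃ₐ[ℂ] _).toAlgHom
      (A.map (algebraMap ℝ ℂ)) (q.map (algebraMap ℝ ℂ))
    rw [aeval_map_algebraMap ℂ (A.map (algebraMap ℝ ℂ)), e1, map_zero] at e2
    exact e2
  have h1 := Module.End.aeval_apply_of_hasEigenvector (p := q.map (algebraMap ℝ ℂ)) hv
  rw [h0, LinearMap.zero_apply, eval_map_algebraMap] at h1
  exact (smul_eq_zero.1 h1.symm).resolve_right hv.2

/-- If a split polynomial annihilates a real endomorphism, then its characteristic polynomial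
splits. -/
theorem LinearMap.splits_charpoly_of_aeval_eq_zero {V : Type*} [AddCommGroup V] [Module ℝ V]
    [Module.Finite ℝ V] (T : Module.End ℝ V) {q : ℝ[X]} (hq : q.Splits) (hq0 : q ≠ 0)
    (h : aeval T q = 0) : T.charpoly.Splits := by
  have hc0 : T.charpoly ≠ 0 := T.charpoly_monic.ne_zero
  -- It suffices that every irreducible factor `p` of the characteristic polynomial divides `q`. A
  -- complex root `w` of `p` is an eigenvalue, so `q(w) = 0`, and `p` is associated to `minpoly ℝ
  -- w`.
  suffices ∃ m, T.charpoly ∣ q ^ m by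
    obtain ⟨m, hm⟩ := this
    exact (hq.pow m).of_dvd (pow_ne_zero m hq0) hm
  rw [UniqueFactorizationMonoid.exists_dvd_pow_iff_radical_dvd hc0,
    UniqueFactorizationMonoid.radical_dvd_iff_primeFactors_subset hq0]
  intro p hp
  rw [UniqueFactorizationMonoid.mem_primeFactors,
    UniqueFactorizationMonoid.mem_normalizedFactors_iff' hc0] at hp
  rw [UniqueFactorizationMonoid.mem_primeFactors,
    UniqueFactorizationMonoid.mem_normalizedFactors_iff' hq0]
  obtain ⟨hi, hn, hd⟩ := hp
  refine ⟨hi, hn, ?_⟩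
  obtain ⟨w, hw⟩ : ∃ w : ℂ, aeval w p = 0 :=
    IsAlgClosed.exists_aeval_eq_zero _ p (degree_pos_of_irreducible hi).ne'
  let b := Module.finBasis ℝ V
  have hA : aeval (LinearMap.toMatrixAlgEquiv b T) q = 0 := by
    rw [aeval_algEquiv, AlgHom.comp_apply, h, map_zero]
  have hcw : aeval w (LinearMap.toMatrixAlgEquiv b T).charpoly = 0 := by
    have : (LinearMap.toMatrixAlgEquiv b T).charpoly = T.charpoly := LinearMap.charpoly_toMatrix T b
    rw [this]
    obtain ⟨r, hr⟩ := hd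
    rw [hr, map_mul, hw, zero_mul]
  have hqw := Matrix.aeval_eq_zero_of_aeval_charpoly_eq_zero hA hcw
  exact (minpoly.eq_of_irreducible hi hw ▸ dvd_mul_right p _ : p ∣ minpoly ℝ w).trans
    (minpoly.dvd ℝ w hqw)

end Eigenvalues

/-! ### Similarity of cyclic matrices -/

section Similarity

/-- If `p` is irreducible, `p ^ k` annihilates `M` and `p ^ (k - 1)` does not, then some vector has
annihilator `p ^ k`. -/
theorem Matrix.exists_vec_annihilator {K : Type*} [Field K] {n : ℕ} {M : Matrix (Fin n) (Fin n) K}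
    {p : K[X]} (hp : Irreducible p) {k : ℕ} (h0 : aeval M (p ^ k) = 0)
    (h1 : aeval M (p ^ (k - 1)) ≠ 0) :
    ∃ v : Fin n → K, ∀ q : K[X], (aeval M q).mulVec v = 0 ↔ p ^ k ∣ q := by
  obtain ⟨v, hv⟩ : ∃ v, (aeval M (p ^ (k - 1))).mulVec v ≠ 0 := by
    by_contra! h
    exact h1 (Matrix.mulVec_injective (funext fun v => by rw [h v, Matrix.zero_mulVec]))
  have hmul : ∀ a b : K[X], (aeval M b).mulVec v = 0 → (aeval M (a * b)).mulVec v = 0 := by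
    intro a b hb
    rw [map_mul, ← Matrix.mulVec_mulVec, hb, Matrix.mulVec_zero]
  have hk : (aeval M (p ^ k)).mulVec v = 0 := by rw [h0, Matrix.zero_mulVec]
  refine ⟨v, fun q => ⟨fun hq => ?_, ?_⟩⟩
  -- By Bézout the gcd of `q` and `p ^ k` also kills `v`. It is associated to some `p ^ i`, and `i <
  -- k` would force `p ^ (k - 1)` to kill `v`.
  · classical
    have hd : (aeval M (EuclideanDomain.gcd q (p ^ k))).mulVec v = 0 := by
      rw [EuclideanDomain.gcd_eq_gcd_ab, map_add, Matrix.add_mulVec, mul_comm q,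
        mul_comm (p ^ k), hmul _ _ hq, hmul _ _ hk, add_zero]
    obtain ⟨i, hi, ha⟩ := (dvd_prime_pow hp.prime k).1 (EuclideanDomain.gcd_dvd_right q (p ^ k))
    rcases hi.eq_or_lt with rfl | hlt
    · exact ha.symm.dvd.trans (EuclideanDomain.gcd_dvd_left q _)
    · exfalso
      obtain ⟨c, hc⟩ := ha.dvd.trans (pow_dvd_pow p (Nat.le_sub_one_of_lt hlt))
      rw [hc, mul_comm] at hv
      exact hv (hmul _ _ hd)
  · rintro ⟨c, rfl⟩
    rw [mul_comm]
    exact hmul _ _ hk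

/-- On polynomials of degree `< n` the map `q ↦ q(M) v` is injective, since the annihilator of `v`
is generated in degree `n`; equal dimensions make it onto. -/
theorem Matrix.surjective_aeval_mulVec {K : Type*} [Field K] {n : ℕ} {M : Matrix (Fin n) (Fin n) K}
    {P : K[X]} (hn : P.natDegree = n) (hP : P ≠ 0) {v : Fin n → K}
    (hv : ∀ q : K[X], (aeval M q).mulVec v = 0 ↔ P ∣ q) (x : Fin n → K) :
    ∃ q : K[X], (aeval M q).mulVec v = x := by
  let Φ : K[X] →ₗ[K] (Fin n → K) :=
    { toFun q := (aeval M q).mulVec v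
      map_add' a b := by rw [map_add, Matrix.add_mulVec]
      map_smul' c a := by rw [map_smul, Matrix.smul_mulVec, RingHom.id_apply] }
  let Ψ : (Fin n → K) →ₗ[K] (Fin n → K) :=
    Φ ∘ₗ (degreeLT K n).subtype ∘ₗ (degreeLTEquiv K n).symm.toLinearMap
  have hinj : Function.Injective Ψ := by
    rw [injective_iff_map_eq_zero]
    intro a ha
    have hd := (hv ((degreeLTEquiv K n).symm a : K[X])).1 ha
    have hlt := mem_degreeLT.1 ((degreeLTEquiv K n).symm a).2
    have hz := eq_zero_of_dvd_of_degree_lt hd (by rwa [degree_eq_natDegree hP, hn])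
    exact (degreeLTEquiv K n).symm.map_eq_zero_iff.1 (Subtype.ext hz)
  obtain ⟨a, ha⟩ := LinearMap.injective_iff_surjective.1 hinj x
  exact ⟨_, ha⟩

/-- Two square matrices of size `natDegree (p ^ k)` annihilated by `p ^ k` but not by
`p ^ (k - 1)`, where `p` is irreducible, are similar. -/
theorem Matrix.exists_linearEquiv_intertwining {K : Type*} [Field K] {n : ℕ}
    {M N : Matrix (Fin n) (Fin n) K} {p : K[X]} (hp : Irreducible p) {k : ℕ}
    (hn : (p ^ k).natDegree = n)
    (hM0 : aeval M (p ^ k) = 0) (hM1 : aeval M (p ^ (k - 1)) ≠ 0)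
    (hN0 : aeval N (p ^ k) = 0) (hN1 : aeval N (p ^ (k - 1)) ≠ 0) :
    ∃ e : (Fin n → K) ≃ₗ[K] (Fin n → K), ∀ x, e (M.mulVec x) = N.mulVec (e x) := by
  obtain ⟨v, hv⟩ := Matrix.exists_vec_annihilator hp hM0 hM1
  obtain ⟨w, hw⟩ := Matrix.exists_vec_annihilator hp hN0 hN1
  have hP := pow_ne_zero k hp.ne_zero
  choose f hf using Matrix.surjective_aeval_mulVec hn hP hv
  -- The intertwiner is `q(M) v ↦ q(N) w`, well defined because `v` and `w` have the same
  -- annihilator.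
  have key : ∀ q r : K[X], (aeval M q).mulVec v = (aeval M r).mulVec v →
      (aeval N q).mulVec w = (aeval N r).mulVec w := by
    intro q r h
    rw [← sub_eq_zero, ← Matrix.sub_mulVec, ← map_sub] at h ⊢
    exact (hw _).2 ((hv _).1 h)
  let g : (Fin n → K) →ₗ[K] (Fin n → K) :=
    { toFun x := (aeval N (f x)).mulVec w
      map_add' x y := by
        rw [← Matrix.add_mulVec, ← map_add]
        exact key _ _ (by rw [map_add, Matrix.add_mulVec, hf, hf, hf])
      map_smul' c x := by
        rw [RingHom.id_apply, ← Matrix.smul_mulVec, ← map_smul]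
        exact key _ _ (by rw [map_smul, Matrix.smul_mulVec, hf, hf]) }
  have hinj : Function.Injective g := by
    rw [injective_iff_map_eq_zero]
    intro x hx
    rw [← hf x]
    exact (hv _).2 ((hw _).1 hx)
  refine ⟨LinearEquiv.ofInjectiveEndo g hinj, fun x => ?_⟩
  change (aeval N (f _)).mulVec w = N.mulVec ((aeval N (f x)).mulVec w)
  rw [key (f (M.mulVec x)) (X * f x)]
  · rw [map_mul, aeval_X, Matrix.mulVec_mulVec]
  · rw [map_mul, aeval_X, ← Matrix.mulVec_mulVec, hf, hf]

end Similarity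

/-! ### Isomorphisms induced by similarity -/

section LieIsomorphism

variable {n : ℕ}

theorem mem_polyLie {M a : Matrix (Fin n) (Fin n) ℝ} :
    a ∈ polyLie M ↔ a ∈ Algebra.adjoin ℝ {M} :=
  Iff.rfl

theorem mem_polyLie_iff {M a : Matrix (Fin n) (Fin n) ℝ} :
    a ∈ polyLie M ↔ ∃ q : ℝ[X], aeval M q = a := by
  rw [mem_polyLie, Algebra.adjoin_singleton_eq_range_aeval]
  rfl

theorem smul_add_algebraMap_mem_polyLie (M : Matrix (Fin n) (Fin n) ℝ) (c r : ℝ) :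
    c • M + algebraMap ℝ _ r ∈ polyLie M :=
  mem_polyLie_iff.2 ⟨C c * X + C r, by simp [Algebra.smul_def]⟩

theorem aeval_mem_polyLie_of_mem {M N : Matrix (Fin n) (Fin n) ℝ} (h : N ∈ polyLie M) (q : ℝ[X]) :
    aeval N q ∈ polyLie M :=
  Algebra.adjoin_le (Set.singleton_subset_iff.2 (mem_polyLie.1 h))
    (aeval_mem_adjoin_singleton ℝ N)

/-- If `e` intertwines `M` with a polynomial in `N` and `e⁻¹` intertwines `N` with a polynomial in
`M`, then the Lie algebras of `M` and `N` are isomorphic. -/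
theorem GLie.nonempty_equiv {M N : Matrix (Fin n) (Fin n) ℝ}
    (e : (Fin n → ℝ) ≃ₗ[ℝ] (Fin n → ℝ)) {M' N' : Matrix (Fin n) (Fin n) ℝ}
    (hM' : M' ∈ polyLie N) (hN' : N' ∈ polyLie M)
    (hM : ∀ x, e (M.mulVec x) = M'.mulVec (e x))
    (hN : ∀ x, e.symm (N.mulVec x) = N'.mulVec (e.symm x)) :
    Nonempty (GLie M ≃ₗ⁅ℝ⁆ GLie N) := by
  let φ : Matrix (Fin n) (Fin n) ℝ ≃ₐ[ℝ] Matrix (Fin n) (Fin n) ℝ :=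
    Matrix.toLinAlgEquiv'.trans (e.conjAlgEquiv ℝ |>.trans Matrix.toLinAlgEquiv'.symm)
  have hφ : ∀ a x, (φ a).mulVec (e x) = e (a.mulVec x) := by
    intro a x
    change Matrix.toLinAlgEquiv' (φ a) (e x) = _
    simp [φ, LinearEquiv.conjAlgEquiv]
  have hφ' : ∀ a x, (φ.symm a).mulVec (e.symm x) = e.symm (a.mulVec x) := by
    intro a x
    rw [e.eq_symm_apply, ← hφ, φ.apply_symm_apply, e.apply_symm_apply]
  have hφM : φ M = M' := Matrix.mulVec_injective (funext fun x => by
    rw [← e.apply_symm_apply x, hφ, hM])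
  have hφN : φ.symm N = N' := Matrix.mulVec_injective (funext fun x => by
    rw [← e.symm_apply_apply x, hφ', hN])
  have h1 : ∀ a ∈ polyLie M, φ a ∈ polyLie N := by
    intro a ha
    obtain ⟨q, rfl⟩ := mem_polyLie_iff.1 ha
    rw [show φ (aeval M q) = aeval (φ M) q by rw [aeval_algEquiv]; rfl, hφM]
    exact aeval_mem_polyLie_of_mem hM' q
  have h2 : ∀ a ∈ polyLie N, φ.symm a ∈ polyLie M := by
    intro a ha
    obtain ⟨q, rfl⟩ := mem_polyLie_iff.1 ha
    rw [show φ.symm (aeval N q) = aeval (φ.symm N) q by rw [aeval_algEquiv]; rfl, hφN]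
    exact aeval_mem_polyLie_of_mem hN' q
  exact ⟨{
    toFun u := ⟨e u.left, ⟨φ u.right, h1 _ u.right.2⟩⟩
    map_add' u v := by
      ext1
      · exact map_add e _ _
      · exact Subtype.ext (map_add φ _ _)
    map_smul' c u := by
      ext1
      · exact map_smul e _ _
      · exact Subtype.ext (map_smul φ _ _)
    map_lie' := by
      intro u v
      rw [GLie.lie_eq, GLie.lie_eq]
      ext1
      · simp only [hφ, map_sub]
      · exact Subtype.ext (map_zero φ)
    invFun u := ⟨e.symm u.left, ⟨φ.symm u.right, h2 _ u.right.2⟩⟩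
    left_inv u := by
      ext1
      · exact e.symm_apply_apply _
      · exact Subtype.ext (φ.symm_apply_apply _)
    right_inv u := by
      ext1
      · exact e.apply_symm_apply _
      · exact Subtype.ext (φ.apply_symm_apply _) }⟩

/-- If some `c M + r` with `c ≠ 0` is similar to `N`, then the Lie algebras of `M` and `N` are
isomorphic. -/
theorem GLie.nonempty_equiv_of_intertwining {M N : Matrix (Fin n) (Fin n) ℝ} {c r : ℝ}
    (hc : c ≠ 0) (e : (Fin n → ℝ) ≃ₗ[ℝ] (Fin n → ℝ))
    (he : ∀ x, e ((c • M + algebraMap ℝ _ r).mulVec x) = N.mulVec (e x)) :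
    Nonempty (GLie M ≃ₗ⁅ℝ⁆ GLie N) := by
  have hs : ∀ (s : ℝ) (x : Fin n → ℝ),
      (algebraMap ℝ (Matrix (Fin n) (Fin n) ℝ) s).mulVec x = s • x := by
    intro s x
    rw [Algebra.algebraMap_eq_smul_one, Matrix.smul_mulVec, Matrix.one_mulVec]
  -- The constants invert the affine change: `M = c⁻¹ (c M + r) - c⁻¹ r`.
  refine GLie.nonempty_equiv e (smul_add_algebraMap_mem_polyLie N c⁻¹ (-(c⁻¹ * r)))
    (smul_add_algebraMap_mem_polyLie M c r) (fun x => ?_) (fun x => ?_)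
  · rw [Matrix.add_mulVec, Matrix.smul_mulVec, hs, ← he, Matrix.add_mulVec, Matrix.smul_mulVec, hs,
      map_add, map_smul, map_smul, smul_add, smul_smul, inv_mul_cancel₀ hc, one_smul, smul_smul,
      neg_smul, add_neg_cancel_right]
  · rw [e.symm_apply_eq, he, e.apply_symm_apply]

end LieIsomorphism

/-! ### Nilpotency of the model matrices -/

section Blocks

theorem nilpotentBlock_pow_apply (n k : ℕ) (i j : Fin n) :
    (nilpotentBlock n ^ k) i j = if j.val = i.val + k then 1 else 0 := by
  induction k generalizing i with
  | zero => simp [Matrix.one_apply, Fin.ext_iff, eq_comm]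
  | succ k ih =>
    rw [pow_succ', Matrix.mul_apply]
    simp_rw [ih]
    simp only [nilpotentBlock, Matrix.of_apply, ite_mul, one_mul, zero_mul]
    by_cases h : i.val + 1 < n
    · rw [Finset.sum_eq_single ⟨i.val + 1, h⟩]
      · simp only [if_true]
        congr 1
        simp only [eq_iff_iff]
        omega
      · intro b _ hb
        rw [if_neg]
        simpa [Fin.ext_iff] using hb
      · simp
    · rw [Finset.sum_eq_zero, if_neg (by omega)]
      intro b _
      rw [if_neg (by omega)]

theorem nilpotentBlock_pow_self (n : ℕ) : nilpotentBlock n ^ n = 0 := by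
  ext i j
  rw [nilpotentBlock_pow_apply, if_neg (by omega), Matrix.zero_apply]

theorem nilpotentBlock_pow_sub_one_ne_zero {n : ℕ} (hn : n ≠ 0) :
    nilpotentBlock n ^ (n - 1) ≠ 0 := by
  intro h
  have := congrFun (congrFun h ⟨0, by omega⟩) ⟨n - 1, by omega⟩
  rw [nilpotentBlock_pow_apply] at this
  simp at this

/-- The complex structure on the plane, as a matrix. -/
def planeRotation : Matrix (Fin 2) (Fin 2) ℝ := !![0, -1; 1, 0]

theorem planeRotation_sq : planeRotation * planeRotation = -1 := by
  ext i j
  fin_cases i <;> fin_cases j <;> simp [planeRotation, Matrix.mul_apply]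

open scoped Kronecker

/-- The Kronecker form makes the semisimple and nilpotent parts visibly commute and reduces powers
to those of `nilpotentBlock m`. -/
theorem complexBlock_reindex (m : ℕ) :
    Matrix.reindexAlgEquiv ℝ ℝ (finProdFinEquiv : Fin m × Fin 2 ≃ Fin (m * 2))
      ((1 : Matrix (Fin m) (Fin m) ℝ) ⊗ₖ planeRotation +
        nilpotentBlock m ⊗ₖ (1 : Matrix (Fin 2) (Fin 2) ℝ)) = complexBlock (m * 2) := by
  rw [Matrix.coe_reindexAlgEquiv, ← Equiv.eq_symm_apply, Matrix.reindex_symm]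
  ext ⟨a, i⟩ ⟨b, j⟩
  simp only [Matrix.add_apply, Matrix.kroneckerMap_apply, Matrix.reindex_apply,
    Matrix.submatrix_apply, Equiv.symm_symm, complexBlock, nilpotentBlock, Matrix.of_apply,
    finProdFinEquiv_apply_val, Matrix.one_apply, Fin.ext_iff, planeRotation, Nat.even_iff]
  fin_cases i <;> fin_cases j <;> simp <;> split_ifs <;> first | omega | simp

/-- If `S ^ 2 = -1` and `N` is nilpotent of index `m` and commutes with `S`, then
`(S + N) ^ 2 + 1` is nilpotent of index `m`. -/
theorem sq_add_one_pow_of_commute {A : Type*} [Ring A] [Algebra ℝ A] {S N : A} (hSN : Commute S N)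
    (hS : S * S = -1) {m : ℕ} (h0 : N ^ m = 0) (h1 : N ^ (m - 1) ≠ 0) :
    ((S + N) ^ 2 + 1) ^ m = 0 ∧ ((S + N) ^ 2 + 1) ^ (m - 1) ≠ 0 := by
  -- The second factor is a unit: `2 S` has inverse `-S / 2`, and `N` is a commuting nilpotent.
  have e : (S + N) ^ 2 + 1 = N * ((2 : ℝ) • S + N) := by
    rw [sq, mul_add, add_mul, add_mul, hS, hSN.eq, mul_add, mul_smul_comm, two_smul]
    abel
  have hc : Commute ((2 : ℝ) • S) N := hSN.smul_left 2
  have hc' : Commute N ((2 : ℝ) • S + N) := hc.symm.add_right (Commute.refl N)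
  have hu : IsUnit ((2 : ℝ) • S + N) := by
    have h2 : IsUnit ((2 : ℝ) • S) :=
      ⟨⟨(2 : ℝ) • S, -(2 : ℝ)⁻¹ • S, by simp [hS], by simp [hS]⟩, rfl⟩
    exact IsNilpotent.isUnit_add_left_of_commute ⟨m, h0⟩ h2 hc.symm
  rw [e, hc'.mul_pow, hc'.mul_pow, h0, zero_mul]
  exact ⟨rfl, fun h => h1 ((hu.pow _).mul_left_eq_zero.1 h)⟩

/-- Supplies the annihilator hypotheses of the similarity theorem for `p = X ^ 2 + 1`. -/
theorem complexBlock_sq_add_one_pow {m : ℕ} (hm : m ≠ 0) :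
    (complexBlock (m * 2) ^ 2 + 1) ^ m = 0 ∧ (complexBlock (m * 2) ^ 2 + 1) ^ (m - 1) ≠ 0 := by
  have hpow : ∀ k, (nilpotentBlock m ⊗ₖ (1 : Matrix (Fin 2) (Fin 2) ℝ)) ^ k =
      (nilpotentBlock m ^ k) ⊗ₖ (1 : Matrix (Fin 2) (Fin 2) ℝ) := by
    intro k
    induction k with
    | zero => simp
    | succ k ih => rw [pow_succ, ih, ← Matrix.mul_kronecker_mul, one_mul, pow_succ]
  obtain ⟨h0, h1⟩ := sq_add_one_pow_of_commute
    (S := (1 : Matrix (Fin m) (Fin m) ℝ) ⊗ₖ planeRotation)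
    (N := nilpotentBlock m ⊗ₖ (1 : Matrix (Fin 2) (Fin 2) ℝ)) (m := m)
    (by rw [commute_iff_eq, ← Matrix.mul_kronecker_mul, ← Matrix.mul_kronecker_mul]; simp)
    (by rw [← Matrix.mul_kronecker_mul, planeRotation_sq, one_mul, ← neg_one_smul ℝ,
      Matrix.kronecker_smul, Matrix.one_kronecker_one, neg_one_smul])
    (by rw [hpow, nilpotentBlock_pow_self, Matrix.zero_kronecker])
    (by
      rw [hpow]
      intro h
      refine nilpotentBlock_pow_sub_one_ne_zero hm (Matrix.ext fun i j => ?_)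
      have := congrFun (congrFun h (i, 0)) (j, 0)
      simpa using this)
  rw [← complexBlock_reindex, ← map_pow, ← map_one (Matrix.reindexAlgEquiv ℝ ℝ finProdFinEquiv),
    ← map_add, ← map_pow, ← map_pow, h0, map_zero]
  exact ⟨rfl, fun h => h1 ((map_eq_zero_iff _ (AlgEquiv.injective _)).1 h)⟩

end Blocks

/-! ### Ideal decompositions and idempotents -/

section Decomposition

variable {n : ℕ}

theorem one_mem_polyLie (M : Matrix (Fin n) (Fin n) ℝ) : 1 ∈ polyLie M :=
  mem_polyLie.2 (one_mem _)

theorem mul_mem_polyLie {M a b : Matrix (Fin n) (Fin n) ℝ} (ha : a ∈ polyLie M)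
    (hb : b ∈ polyLie M) : a * b ∈ polyLie M :=
  mem_polyLie.2 (mul_mem (mem_polyLie.1 ha) (mem_polyLie.1 hb))

theorem commute_of_mem_polyLie {M a b : Matrix (Fin n) (Fin n) ℝ} (ha : a ∈ polyLie M)
    (hb : b ∈ polyLie M) : a * b = b * a := by
  obtain ⟨p, rfl⟩ := mem_polyLie_iff.1 ha
  obtain ⟨q, rfl⟩ := mem_polyLie_iff.1 hb
  rw [← map_mul, mul_comm, map_mul]

/-- The ideal of `𝒢_M` spanned by the elements fixed by a given polynomial in `M`. -/
def GLie.fixedIdeal (M : Matrix (Fin n) (Fin n) ℝ) {e : Matrix (Fin n) (Fin n) ℝ}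
    (he : e ∈ polyLie M) : LieIdeal ℝ (GLie M) where
  carrier := {u | e.mulVec u.left = u.left ∧ e * u.right = u.right}
  zero_mem' := ⟨Matrix.mulVec_zero e, mul_zero e⟩
  add_mem' := by
    rintro u v ⟨h1, h2⟩ ⟨h3, h4⟩
    refine ⟨?_, ?_⟩
    · change e.mulVec (u.left + v.left) = u.left + v.left
      rw [Matrix.mulVec_add, h1, h3]
    · change e * ((u.right : Matrix (Fin n) (Fin n) ℝ) + v.right) = u.right + v.right
      rw [mul_add, h2, h4]
  smul_mem' := by
    rintro c u ⟨h1, h2⟩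
    refine ⟨?_, ?_⟩
    · change e.mulVec (c • u.left) = c • u.left
      rw [Matrix.mulVec_smul, h1]
    · change e * (c • (u.right : Matrix (Fin n) (Fin n) ℝ)) = c • u.right
      rw [mul_smul_comm, h2]
  lie_mem := by
    rintro u v ⟨h1, h2⟩
    rw [GLie.lie_eq]
    refine ⟨?_, mul_zero e⟩
    change e.mulVec (_ - _) = _ - _
    rw [Matrix.mulVec_sub, Matrix.mulVec_mulVec, Matrix.mulVec_mulVec, h2,
      commute_of_mem_polyLie he u.right.2, ← Matrix.mulVec_mulVec, h1]

/-- Peirce decomposition: `u = e u + f u`, while `e u = u = f u` forces `u = e f u = 0`. -/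
theorem GLie.isCompl_fixedIdeal {M e f : Matrix (Fin n) (Fin n) ℝ} (he : e ∈ polyLie M)
    (hf : f ∈ polyLie M) (hef : e + f = 1) (h0 : e * f = 0) :
    IsCompl (GLie.fixedIdeal M he) (GLie.fixedIdeal M hf) := by
  have h0' : f * e = 0 := by rw [commute_of_mem_polyLie hf he, h0]
  have hee : e * e = e := by
    have := congrArg (e * ·) hef
    simpa [mul_add, h0] using this
  have hff : f * f = f := by
    have := congrArg (f * ·) hef
    simpa [mul_add, h0'] using this
  constructor
  · rw [disjoint_iff, LieSubmodule.eq_bot_iff]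
    rintro u hu
    obtain ⟨⟨h1, h2⟩, h3, h4⟩ := (LieSubmodule.mem_inf _ _ _).1 hu
    ext1
    · change u.left = 0
      rw [← h1, ← h3, Matrix.mulVec_mulVec, h0, Matrix.zero_mulVec]
    · apply Subtype.ext
      change (u.right : Matrix (Fin n) (Fin n) ℝ) = 0
      rw [← h2, ← h4, ← mul_assoc, h0, zero_mul]
  · rw [codisjoint_iff, eq_top_iff]
    rintro u -
    rw [LieSubmodule.mem_sup]
    refine ⟨⟨e.mulVec u.left, ⟨e * u.right, mul_mem_polyLie he u.right.2⟩⟩, ⟨?_, ?_⟩,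
      ⟨f.mulVec u.left, ⟨f * u.right, mul_mem_polyLie hf u.right.2⟩⟩, ⟨?_, ?_⟩, ?_⟩
    · simp only [Matrix.mulVec_mulVec, hee]
    · simp only [← mul_assoc, hee]
    · simp only [Matrix.mulVec_mulVec, hff]
    · simp only [← mul_assoc, hff]
    · ext1
      · change e.mulVec u.left + f.mulVec u.left = u.left
        rw [← Matrix.add_mulVec, hef, Matrix.one_mulVec]
      · apply Subtype.ext
        change e * (u.right : Matrix (Fin n) (Fin n) ℝ) + f * u.right = u.right
        rw [← add_mul, hef, one_mul]

theorem GLie.fixedIdeal_ne_bot {M e : Matrix (Fin n) (Fin n) ℝ} (he : e ∈ polyLie M)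
    (hee : e * e = e) (h0 : e ≠ 0) : GLie.fixedIdeal M he ≠ ⊥ := by
  intro h
  have hm : (⟨0, ⟨e, he⟩⟩ : GLie M) ∈ GLie.fixedIdeal M he := ⟨Matrix.mulVec_zero e, hee⟩
  rw [h, LieSubmodule.mem_bot] at hm
  exact h0 (congrArg (fun u : GLie M => (u.right : Matrix (Fin n) (Fin n) ℝ)) hm)

/-- A decomposition of `𝒢_M` into two ideals is trivial if `ℝ[M]` has no nontrivial idempotents. -/
theorem GLie.eq_bot_or_eq_bot_of_isCompl {M : Matrix (Fin n) (Fin n) ℝ}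
    (hM : ∀ e ∈ polyLie M, e * (1 - e) = 0 → e = 0 ∨ 1 - e = 0) {I J : LieIdeal ℝ (GLie M)}
    (h : IsCompl I J) : I = ⊥ ∨ J = ⊥ := by
  have hdisj : ∀ u : GLie M, u ∈ I → u ∈ J → u = 0 := fun u h1 h2 =>
    by
    rw [← LieSubmodule.mem_bot (R := ℝ) (L := GLie M), ← disjoint_iff.1 h.disjoint]
    exact (LieSubmodule.mem_inf _ _ _).2 ⟨h1, h2⟩
  -- If `1 ∈ J`, then `[1, y] = y` puts `ℝⁿ` inside `J`. For `u ∈ I` with matrix part `a`, `[u, y] =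
  -- a y` lies in `I ∩ J`, so `a = 0`; then `u ∈ ℝⁿ ⊆ J` vanishes.
  have hlie : ∀ {I J : LieIdeal ℝ (GLie M)}, (∀ u : GLie M, u ∈ I → u ∈ J → u = 0) →
      (⟨0, ⟨1, one_mem_polyLie M⟩⟩ : GLie M) ∈ J → I = ⊥ := by
    intro I J hd h1
    have hV : ∀ y : Fin n → ℝ, (⟨y, 0⟩ : GLie M) ∈ J := by
      intro y
      have := lie_mem_left ℝ (GLie M) J _ ⟨y, 0⟩ h1
      rw [GLie.lie_eq] at this
      simpa using this
    rw [LieSubmodule.eq_bot_iff]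
    intro u hu
    have hb : (u.right : Matrix (Fin n) (Fin n) ℝ) = 0 := by
      refine Matrix.mulVec_injective (funext fun y => ?_)
      have := hd ⁅u, ⟨y, 0⟩⁆ (lie_mem_left ℝ (GLie M) I _ _ hu)
        (lie_mem_right ℝ (GLie M) J _ _ (hV y))
      rw [GLie.lie_eq] at this
      have := congrArg (fun u : GLie M => u.left) this
      simpa using this
    refine hd u hu ?_
    have : u = ⟨u.left, 0⟩ := by
      ext1
      · rfl
      · exact Subtype.ext hb
    rw [this]
    exact hV _
  have htop : (⟨0, ⟨1, one_mem_polyLie M⟩⟩ : GLie M) ∈ I ⊔ J := by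
    rw [codisjoint_iff.1 h.codisjoint]
    exact LieSubmodule.mem_top _
  obtain ⟨u, hu, v, hv, huv⟩ := (LieSubmodule.mem_sup _ _ _).1 htop
  have hl : v.left = -u.left :=
    eq_neg_of_add_eq_zero_right (congrArg (fun u : GLie M => u.left) huv)
  have hr : (v.right : Matrix (Fin n) (Fin n) ℝ) = 1 - u.right :=
    eq_sub_of_add_eq' (congrArg (fun u : GLie M => (u.right : Matrix (Fin n) (Fin n) ℝ)) huv)
  -- With `u = a + x` and `v = (1 - a) - x`, the bracket `[u, v] = -x` lies in `I ∩ J`.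
  have hx : u.left = 0 := by
    have := hdisj ⁅u, v⁆ (lie_mem_left ℝ (GLie M) I _ _ hu) (lie_mem_right ℝ (GLie M) J _ _ hv)
    rw [GLie.lie_eq] at this
    have := congrArg (fun u : GLie M => u.left) this
    simp only [hl, hr, Matrix.sub_mulVec, Matrix.mulVec_neg, Matrix.one_mulVec] at this
    rw [← neg_eq_zero, ← show _ = (0 : Fin n → ℝ) from this]
    abel
  -- Likewise `[u, [v, y]] = a (1 - a) y` lies in `I ∩ J` for every `y`.
  have hidem : (u.right : Matrix (Fin n) (Fin n) ℝ) * (1 - u.right) = 0 := by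
    refine Matrix.mulVec_injective (funext fun y => ?_)
    have h1 := hdisj ⁅u, ⁅v, ⟨y, 0⟩⁆⁆ (lie_mem_left ℝ (GLie M) I _ _ hu)
      (lie_mem_right ℝ (GLie M) J _ _ (lie_mem_left ℝ (GLie M) J _ _ hv))
    rw [GLie.lie_eq M v, GLie.lie_eq] at h1
    have := congrArg (fun u : GLie M => u.left) h1
    simpa [hr] using this
  rcases hM _ u.right.2 hidem with h1 | h1
  · left
    refine hlie hdisj ?_
    convert hv using 1
    ext1
    · change 0 = v.left
      rw [hl, hx, neg_zero]
    · apply Subtype.ext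
      change 1 = (v.right : Matrix (Fin n) (Fin n) ℝ)
      rw [hr, h1, sub_zero]
  · right
    refine hlie (fun w h1 h2 => hdisj w h2 h1) ?_
    convert hu using 1
    ext1
    · exact hx.symm
    · exact Subtype.ext (sub_eq_zero.1 h1)

/-- `𝒢_M` is indecomposable if and only if the minimal polynomial of `M` is a nontrivial power of
an irreducible polynomial. -/
theorem lieIndecomposable_GLie_iff (M : Matrix (Fin n) (Fin n) ℝ) :
    LieIndecomposable (GLie M) ↔
      ∃ (p : ℝ[X]) (k : ℕ), p.Monic ∧ Irreducible p ∧ k ≠ 0 ∧ minpoly ℝ M = p ^ k := by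
  have hint : IsIntegral ℝ M := IsIntegral.of_finite ℝ M
  constructor
  · rintro ⟨hnt, hdec⟩
    rcases (minpoly.monic hint).eq_one_or_eq_irreducible_pow_or_eq_mul_coprime with h1 | h |
      ⟨f, g, hfg, hc, hf, hg⟩
    · exfalso
      have h10 : (1 : Matrix (Fin n) (Fin n) ℝ) = 0 := by
        simpa [h1] using minpoly.aeval ℝ M
      obtain ⟨u, hu⟩ := exists_ne (0 : GLie M)
      refine hu ?_
      ext1
      · change u.left = 0
        rw [← Matrix.one_mulVec u.left, h10, Matrix.zero_mulVec]
      · apply Subtype.ext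
        change (u.right : Matrix (Fin n) (Fin n) ℝ) = 0
        rw [← one_mul (u.right : Matrix (Fin n) (Fin n) ℝ), h10, zero_mul]
    · exact h
    · exfalso
      obtain ⟨a, b, hab⟩ := hc
      have hef : aeval M (a * f) + aeval M (b * g) = 1 := by rw [← map_add, hab, map_one]
      have h0 : aeval M (a * f) * aeval M (b * g) = 0 := by
        rw [← map_mul, show a * f * (b * g) = a * b * (f * g) by ring, ← hfg, map_mul,
          minpoly.aeval, mul_zero]
      have h0' : aeval M (b * g) * aeval M (a * f) = 0 := by rw [← map_mul, mul_comm, map_mul, h0]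
      have he : aeval M (a * f) ∈ polyLie M := mem_polyLie_iff.2 ⟨a * f, rfl⟩
      have hf' : aeval M (b * g) ∈ polyLie M := mem_polyLie_iff.2 ⟨b * g, rfl⟩
      have hee : aeval M (a * f) * aeval M (a * f) = aeval M (a * f) := by
        have := congrArg (aeval M (a * f) * ·) hef
        simpa only [mul_add, h0, add_zero, mul_one] using this
      have hff : aeval M (b * g) * aeval M (b * g) = aeval M (b * g) := by
        have := congrArg (aeval M (b * g) * ·) hef
        simpa only [mul_add, h0', zero_add, mul_one] using this
      rcases hdec _ _ (GLie.isCompl_fixedIdeal he hf' hef h0) with h | h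
      -- If the idempotent `(a f)(M)` were zero, `g` would divide `a f`, to which it is coprime, and
      -- so be a unit.
      · refine GLie.fixedIdeal_ne_bot he hee (fun hz => hg ?_) h
        have := minpoly.dvd ℝ M hz
        rw [hfg] at this
        have h2 : IsCoprime (a * f) g := ⟨1, b, by rw [one_mul, hab]⟩
        exact h2.isUnit_of_dvd' ((dvd_mul_left g f).trans this) dvd_rfl
      · refine GLie.fixedIdeal_ne_bot hf' hff (fun hz => hf ?_) h
        have := minpoly.dvd ℝ M hz
        rw [hfg] at this
        have h2 : IsCoprime f (b * g) := ⟨a, 1, by rw [one_mul, hab]⟩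
        exact h2.isUnit_of_dvd' dvd_rfl ((dvd_mul_right f g).trans this)
  · rintro ⟨p, k, hm, hi, hk, hP⟩
    refine ⟨?_, fun I J h => GLie.eq_bot_or_eq_bot_of_isCompl (fun e he hz => ?_) h⟩
    · have h10 : (1 : Matrix (Fin n) (Fin n) ℝ) ≠ 0 := by
        intro h
        have := minpoly.dvd ℝ M (p := 1) (by rw [map_one, h])
        rw [hP] at this
        exact hi.not_isUnit (isUnit_of_dvd_one ((dvd_pow_self p hk).trans this))
      refine ⟨⟨0, ⟨1, one_mem_polyLie M⟩⟩, 0, fun h => h10 ?_⟩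
      exact congrArg (fun u : GLie M => (u.right : Matrix (Fin n) (Fin n) ℝ)) h
    · obtain ⟨q, rfl⟩ := mem_polyLie_iff.1 he
      have e1 : 1 - aeval M q = aeval M (1 - q) := by rw [map_sub, map_one]
      rw [e1] at hz ⊢
      rw [← map_mul] at hz
      have hd := minpoly.dvd ℝ M hz
      rw [hP] at hd
      have key : ∀ r, p ^ k ∣ r → aeval M r = 0 := by
        rintro r ⟨c, rfl⟩
        rw [← hP, map_mul, minpoly.aeval, zero_mul]
      -- `p` cannot divide both `q` and `1 - q`, so `p ^ k` divides one of them entirely.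
      by_cases hpq : p ∣ q
      · left
        refine key q (IsCoprime.dvd_of_dvd_mul_right (IsCoprime.pow_left ?_) hd)
        refine hi.coprime_iff_not_dvd.2 fun h => hi.not_isUnit (isUnit_of_dvd_one ?_)
        simpa using dvd_add hpq h
      · right
        exact key _ (IsCoprime.dvd_of_dvd_mul_left (hi.coprime_iff_not_dvd.2 hpq).pow_left hd)

end Decomposition

/-! ### Solvability and real spectrum -/

section CompletelySolvable

variable {n : ℕ}

/-- All brackets lie in `ℝⁿ`, which is abelian, so the second derived algebra vanishes. -/
theorem GLie.isSolvable (M : Matrix (Fin n) (Fin n) ℝ) : LieAlgebra.IsSolvable (GLie M) := by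
  let A : LieIdeal ℝ (GLie M) :=
    { carrier := {u | u.right = 0}
      zero_mem' := rfl
      add_mem' := by
        intro u v hu hv
        change u.right + v.right = 0
        rw [show u.right = 0 from hu, show v.right = 0 from hv, add_zero]
      smul_mem' := by
        intro c u hu
        change c • u.right = 0
        rw [show u.right = 0 from hu, smul_zero]
      lie_mem := by
        intro u v _
        rw [GLie.lie_eq]
        rfl }
  rw [LieAlgebra.isSolvable_iff ℝ]
  have h1 : LieAlgebra.derivedSeries ℝ (GLie M) 1 ≤ A := by
    rw [LieAlgebra.derivedSeries_def, LieAlgebra.derivedSeriesOfIdeal_succ, LieSubmodule.lie_le_iff]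
    intro u _ v _
    change ⁅u, v⁆.right = 0
    rw [GLie.lie_eq]
  refine ⟨2, ?_⟩
  rw [LieAlgebra.derivedSeries_def, LieAlgebra.derivedSeriesOfIdeal_succ, eq_bot_iff,
    LieSubmodule.lie_le_iff]
  intro u hu v hv
  have hu' : u.right = 0 := h1 hu
  have hv' : v.right = 0 := h1 hv
  rw [LieSubmodule.mem_bot, GLie.lie_eq, hu', hv']
  ext1
  · change Matrix.mulVec 0 _ - Matrix.mulVec 0 _ = 0
    rw [Matrix.zero_mulVec, Matrix.zero_mulVec, sub_zero]
  · rfl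

/-- If a power of `M - r` vanishes, then every polynomial in `M` is the sum of a scalar and a
nilpotent matrix. -/
theorem exists_sub_algebraMap_pow_eq_zero {M a : Matrix (Fin n) (Fin n) ℝ} {r : ℝ} {k : ℕ}
    (hM : aeval M ((X - C r) ^ k) = 0) (ha : a ∈ polyLie M) :
    ∃ c : ℝ, (a - algebraMap ℝ _ c) ^ k = 0 := by
  obtain ⟨q, rfl⟩ := mem_polyLie_iff.1 ha
  -- `X - r` divides `q - q(r)`.
  refine ⟨q.eval r, ?_⟩
  obtain ⟨s, hs⟩ := X_sub_C_dvd_sub_C_eval (p := q) (a := r)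
  have : aeval M q - algebraMap ℝ _ (q.eval r) = aeval M (q - C (q.eval r)) := by
    rw [map_sub, aeval_C]
  rw [this, ← map_pow, hs, mul_pow, map_mul, hM, zero_mul]

/-- `ad u` has image in `ℝⁿ` and acts there as the matrix part of `u`, a scalar `c` plus a
nilpotent. Thus `(ad u - c) ^ k * ad u = 0`, a split annihilating polynomial. -/
theorem GLie.completelySolvable {M : Matrix (Fin n) (Fin n) ℝ} {r : ℝ} {k : ℕ}
    (hM : aeval M ((X - C r) ^ k) = 0) : LieCompletelySolvable (GLie M) := by
  refine ⟨GLie.isSolvable M, fun u => ?_⟩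
  obtain ⟨c, hc⟩ := exists_sub_algebraMap_pow_eq_zero hM u.right.2
  refine LinearMap.splits_charpoly_of_aeval_eq_zero (LieAlgebra.ad ℝ (GLie M) u)
    (q := (X - C c) ^ k * X) (((Splits.X_sub_C c).pow k).mul Splits.X)
    (mul_ne_zero (pow_ne_zero k (X_sub_C_ne_zero c)) X_ne_zero) ?_
  have key : ∀ (j : ℕ) (y : Fin n → ℝ),
      ((LieAlgebra.ad ℝ (GLie M) u - algebraMap ℝ _ c) ^ j) (⟨y, 0⟩ : GLie M) =
        ⟨((u.right - algebraMap ℝ (Matrix (Fin n) (Fin n) ℝ) c) ^ j).mulVec y, 0⟩ := by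
    intro j
    induction j with
    | zero =>
      intro y
      rw [pow_zero, pow_zero, Matrix.one_mulVec]
      rfl
    | succ j ih =>
      intro y
      rw [pow_succ, Module.End.mul_apply, pow_succ, ← Matrix.mulVec_mulVec, ← ih]
      congr 1
      rw [LinearMap.sub_apply, LieAlgebra.ad_apply, GLie.lie_eq, Module.algebraMap_end_apply,
        Matrix.sub_mulVec, Algebra.algebraMap_eq_smul_one, Matrix.smul_mulVec, Matrix.one_mulVec]
      ext1
      · change _ - Matrix.mulVec 0 _ - c • y = _
        rw [Matrix.zero_mulVec, sub_zero]
      · change (0 : polyLie M) - c • 0 = 0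
        rw [smul_zero, sub_zero]
  ext1 w
  rw [map_mul, aeval_X, map_pow, map_sub, aeval_X, aeval_C, Module.End.mul_apply,
    LieAlgebra.ad_apply, GLie.lie_eq, key, hc, Matrix.zero_mulVec]
  rfl

end CompletelySolvable

/-! ### Normal forms from the minimal polynomial -/

section Classification

variable {n : ℕ} {M : Matrix (Fin n) (Fin n) ℝ}

theorem aeval_pow_sub_one_ne_zero {p : ℝ[X]} (hp : Irreducible p) {k : ℕ} (hk : k ≠ 0)
    (hM : minpoly ℝ M = p ^ k) : aeval M (p ^ (k - 1)) ≠ 0 := by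
  intro h
  have := minpoly.dvd ℝ M h
  rw [hM, pow_dvd_pow_iff hp.ne_zero hp.not_isUnit] at this
  omega

theorem aeval_pow_eq_zero {p : ℝ[X]} {k : ℕ} (hM : minpoly ℝ M = p ^ k) :
    aeval M (p ^ k) = 0 := by
  rw [← hM, minpoly.aeval]

/-- The translate `M - r` is annihilated by `X ^ n` but not by `X ^ (n - 1)`, just like the
nilpotent block. -/
theorem GLie.nonempty_equiv_D0 {r : ℝ} (hn : n ≠ 0) (hM : minpoly ℝ M = (X - C r) ^ n) :
    Nonempty (GLie M ≃ₗ⁅ℝ⁆ D0 n) := by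
  have hN : ∀ k, aeval ((1 : ℝ) • M + algebraMap ℝ _ (-r)) ((X : ℝ[X]) ^ k) =
      aeval M ((X - C r) ^ k) := by
    intro k
    simp [sub_eq_add_neg]
  obtain ⟨e, he⟩ := Matrix.exists_linearEquiv_intertwining (k := n)
    (M := (1 : ℝ) • M + algebraMap ℝ _ (-r)) (N := nilpotentBlock n) (irreducible_X (R := ℝ))
    (natDegree_X_pow n) (by rw [hN, aeval_pow_eq_zero hM])
    (by rw [hN]; exact aeval_pow_sub_one_ne_zero (irreducible_X_sub_C r) hn hM)
    (by rw [map_pow, aeval_X, nilpotentBlock_pow_self])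
    (by rw [map_pow, aeval_X]; exact nilpotentBlock_pow_sub_one_ne_zero hn)
  exact GLie.nonempty_equiv_of_intertwining one_ne_zero e he

theorem irreducible_X_sq_add_one : Irreducible (X ^ 2 + 1 : ℝ[X]) := by
  have h := minpoly.irreducible (IsIntegral.of_finite ℝ Complex.I)
  rw [minpoly_real_complex_eq (by simp)] at h
  simpa using h

/-- The matrix `b⁻¹ (M - a)` has its eigenvalues moved from `a ± b i` to `± i`, so `X ^ 2 + 1` takes
over the role of the quadratic. -/
theorem GLie.nonempty_equiv_D01 {m : ℕ} {M : Matrix (Fin (m * 2)) (Fin (m * 2)) ℝ} {a b : ℝ}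
    (hm : m ≠ 0) (hb : b ≠ 0) (hi : Irreducible ((X - C a) ^ 2 + C (b ^ 2) : ℝ[X]))
    (hM : minpoly ℝ M = ((X - C a) ^ 2 + C (b ^ 2)) ^ m) :
    Nonempty (GLie M ≃ₗ⁅ℝ⁆ D01 (m * 2)) := by
  have hp : (C b⁻¹ * X + C (-(b⁻¹ * a))) ^ 2 + 1 =
      C (b⁻¹ ^ 2) * ((X - C a) ^ 2 + C (b ^ 2)) := by
    have h1 : (C b⁻¹ * C b : ℝ[X]) = 1 := by rw [← C_mul, inv_mul_cancel₀ hb, C_1]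
    simp only [map_pow, map_neg, map_mul]
    linear_combination (-1 - C b⁻¹ * C b : ℝ[X]) * h1
  have hN : ∀ k, aeval (b⁻¹ • M + algebraMap ℝ _ (-(b⁻¹ * a))) ((X ^ 2 + 1 : ℝ[X]) ^ k) =
      (b⁻¹ ^ 2) ^ k • aeval M (((X - C a) ^ 2 + C (b ^ 2)) ^ k) := by
    intro k
    have e1 : b⁻¹ • M + algebraMap ℝ _ (-(b⁻¹ * a)) = aeval M (C b⁻¹ * X + C (-(b⁻¹ * a))) := by
      rw [map_add, map_mul, aeval_X, aeval_C, aeval_C, Algebra.smul_def]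
    rw [e1, map_pow, map_add, map_pow, aeval_X, map_one, ← map_pow, ← map_one (aeval (R := ℝ) M), ← map_add,
      hp, map_mul, aeval_C, ← Algebra.smul_def, _root_.smul_pow,
      ← map_pow (aeval M) _ k]
  have hB : ∀ k, aeval (complexBlock (m * 2)) ((X ^ 2 + 1 : ℝ[X]) ^ k) =
      (complexBlock (m * 2) ^ 2 + 1) ^ k := by
    intro k
    rw [map_pow, map_add, map_pow, aeval_X, map_one]
  obtain ⟨h0, h1⟩ := complexBlock_sq_add_one_pow hm
  obtain ⟨e, he⟩ := Matrix.exists_linearEquiv_intertwining (k := m)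
    (M := b⁻¹ • M + algebraMap ℝ _ (-(b⁻¹ * a))) (N := complexBlock (m * 2))
    irreducible_X_sq_add_one
    (by rw [natDegree_pow, ← C_1, natDegree_X_pow_add_C])
    (by rw [hN, aeval_pow_eq_zero hM, smul_zero])
    (by
      rw [hN]
      exact smul_ne_zero (pow_ne_zero _ (pow_ne_zero _ (inv_ne_zero hb)))
        (aeval_pow_sub_one_ne_zero hi hm hM))
    (by rw [hB, h0]) (by rwa [hB])
  exact GLie.nonempty_equiv_of_intertwining (inv_ne_zero hb) e he

theorem exists_minpoly_eq_pow (hM : IsNonderogatory M) {z : ℂ} (hz : z ∈ complexEigenvalues M)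
    (h : ∀ w ∈ complexEigenvalues M, w = z ∨ w = conj z) :
    ∃ k, k ≠ 0 ∧ minpoly ℝ M = minpoly ℝ z ^ k := by
  obtain ⟨k, hk⟩ := (Matrix.charpoly_monic M).eq_minpoly_pow
    (fun w hw => h w ((mem_complexEigenvalues_iff M w).2 hw))
  refine ⟨k, ?_, hM ▸ hk⟩
  rintro rfl
  rw [mem_complexEigenvalues_iff, hk, pow_zero, map_one] at hz
  exact one_ne_zero hz

theorem im_eq_zero_of_complexEigenvalues_eq_singleton {z : ℂ} (h : complexEigenvalues M = {z}) :
    z.im = 0 := by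
  have := conj_mem_complexEigenvalues (h ▸ Set.mem_singleton z : z ∈ complexEigenvalues M)
  rw [h, Set.mem_singleton_iff] at this
  exact Complex.conj_eq_iff_im.1 this

theorem natDegree_minpoly_of_isNonderogatory (hM : IsNonderogatory M) :
    (minpoly ℝ M).natDegree = n := by
  rw [← show M.charpoly = _ from hM, Matrix.charpoly_natDegree_eq_dim, Fintype.card_fin]

end Classification

theorem mainTheorem9 (n : ℕ) (M : Matrix (Fin n) (Fin n) ℝ) (hM : IsNonderogatory M) :
    (LieIndecomposable (GLie M) ↔
      (∃ z : ℂ, complexEigenvalues M = {z}) ∨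
      (∃ z : ℂ, z.im ≠ 0 ∧ complexEigenvalues M = {z, conj z})) ∧
    (∀ z : ℂ, complexEigenvalues M = {z} →
      z.im = 0 ∧ Nonempty (GLie M ≃ₗ⁅ℝ⁆ D0 n) ∧ LieCompletelySolvable (GLie M)) ∧
    (∀ z : ℂ, z.im ≠ 0 → complexEigenvalues M = {z, conj z} →
      Even n ∧ Nonempty (GLie M ≃ₗ⁅ℝ⁆ D01 n)) := by
  have hsingle : ∀ z : ℂ, complexEigenvalues M = {z} →
      ∃ k, k ≠ 0 ∧ minpoly ℝ M = minpoly ℝ z ^ k := fun z hz =>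
    exists_minpoly_eq_pow hM (hz ▸ Set.mem_singleton z) fun w hw => by
      rw [hz] at hw
      exact Or.inl hw
  have hpair : ∀ z : ℂ, complexEigenvalues M = {z, conj z} →
      ∃ k, k ≠ 0 ∧ minpoly ℝ M = minpoly ℝ z ^ k := fun z hz =>
    exists_minpoly_eq_pow hM (hz ▸ Set.mem_insert z _) fun w hw => by
      rw [hz] at hw
      exact hw
  refine ⟨?_, fun z hz => ?_, fun z him hz => ?_⟩
  · rw [lieIndecomposable_GLie_iff]
    constructor
    · rintro ⟨p, k, hm, hi, hk, hP⟩
      obtain ⟨z, hz⟩ : ∃ z : ℂ, aeval z p = 0 :=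
        IsAlgClosed.exists_aeval_eq_zero _ p (degree_pos_of_irreducible hi).ne'
      -- A monic irreducible polynomial is the minimal polynomial of any of its roots.
      rw [minpoly.eq_of_irreducible_of_monic hi hz hm] at hP
      have h := complexEigenvalues_eq hk ((show M.charpoly = _ from hM).trans hP)
      by_cases him : z.im = 0
      · refine Or.inl ⟨z, ?_⟩
        rw [h, Complex.conj_eq_iff_im.2 him, Set.pair_eq_singleton]
      · exact Or.inr ⟨z, him, h⟩
    · intro h
      obtain ⟨z, k, hk, hP⟩ : ∃ (z : ℂ) (k : ℕ), k ≠ 0 ∧ minpoly ℝ M = minpoly ℝ z ^ k := by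
        rcases h with ⟨z, hz⟩ | ⟨z, -, hz⟩
        · exact ⟨z, hsingle z hz⟩
        · exact ⟨z, hpair z hz⟩
      have hint := IsIntegral.of_finite ℝ z
      exact ⟨_, k, minpoly.monic hint, minpoly.irreducible hint, hk, hP⟩
  · have him := im_eq_zero_of_complexEigenvalues_eq_singleton hz
    obtain ⟨k, hk, hP⟩ := hsingle z hz
    -- Comparing degrees gives `k = n` here, and `n = k * 2` in the nonreal case.
    have hd := natDegree_minpoly_of_isNonderogatory hM
    rw [minpoly_real_complex_of_im_eq_zero him] at hP
    rw [hP, natDegree_pow, natDegree_X_sub_C, mul_one] at hd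
    subst hd
    exact ⟨him, GLie.nonempty_equiv_D0 hk hP, GLie.completelySolvable (aeval_pow_eq_zero hP)⟩
  · obtain ⟨k, hk, hP⟩ := hpair z hz
    have hd := natDegree_minpoly_of_isNonderogatory hM
    have hi := minpoly.irreducible (IsIntegral.of_finite ℝ z)
    rw [minpoly_real_complex_eq him] at hP hi
    rw [hP, natDegree_pow, natDegree_add_C, natDegree_pow, natDegree_X_sub_C] at hd
    subst hd
    exact ⟨even_two.mul_left k, GLie.nonempty_equiv_D01 hk him hi hP⟩
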